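/- Fix real constants $a\ge 1$ and $b\ge 0$. An instance on $n$ nodes consists of a connected simple graph $G=(V,E)$ with $|V|=n$, integer edge weights $w:E\to[1,n^b]$ (for $b=0$ the graph is unweighted), a label $x(v)\in\{0,1\}^*$ at every node $v$, and pairwise distinct identities $\mathrm{id}(v)\in[1,n^a]$. The predicate $\mathrm{DIAM}$ holds on an instance if, for every node $v$, the label $x(v)$ is the binary representation of the weighted diameter of $G$. A proof-labeling scheme of radius at most $t$ for $\mathrm{DIAM}$ on $n$-node instances is a pair $(\mathbf p,\mathbf v)$: the prover $\mathbf p$ assigns a bit string (certificate) to every node of every instance; the verifier $\mathbf v$ accepts or rejects at each node $v$ as a function of the ball of radius $t$ (in hops) around $v$, i.e. of the identities, labels and certificates of the nodes at distance at most $t$ from $v$ and of the weighted edges between them. If the instance satisfies $\mathrm{DIAM}$, then with the certificates of $\mathbf p$ all nodes accept; if it does not, then for every assignment of certificates at least one node rejects. The size of the scheme is the maximal length of a certificate assigned by $\mathbf p$ to a node of an $n$-node instance satisfying $\mathrm{DIAM}$, and $\mathsf{size\text{-}pls}(\mathrm{DIAM},t)$, a function of $n$, is the minimal size of a scheme of radius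 at most $t$. Then: 1. There is a constant $c>0$ such that (a) there is a constant $C>0$ with $\mathsf{size\text{-}pls}(\mathrm{DIAM},t)\le C\,\dfrac{n\log^2 n}{t}$ for all $n$ and all integers $t\ge 1$ with $c\log n\le t\le n$; (b) $\mathrm{DIAM}$ weakly scales linearly on $[c\log n,\,n/\log n]$: there are constants $C>0$ and $k\in\mathbb N$ such that, for all sufficiently large $n$ and all integers $t\ge1$ with $c\log n\le t\le n/\log n$, there is a proof-labeling scheme for $\mathrm{DIAM}$ of radius at most $t$ and of size at most $C\,\dfrac{\log^k n}{t}\cdot\mathsf{size\text{-}pls}(\mathrm{DIAM},1)$. 2. Conversely, there is a constant $\delta>0$ such that, for all sufficiently large $n$ and all integers $t$ with $1\le t\le n/\log n$, $\mathsf{size\text{-}pls}(\mathrm{DIAM},t)\ge \delta\,\dfrac{n}{t\log n}$. All constants depend only on $a$ and $b$. -/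

import Mathlib

open scoped ENNReal

namespace ProofLabeling

/-- An instance `(G, x, id)` with `n` nodes: a connected simple graph `G` with integer edge weights
in `[1, n ^ b]`, a label (bit string) at every node, and pairwise distinct identities in
`[1, n ^ a]`. For `b = 0` all weights are `1`, so these are the unweighted graphs. -/
structure Inst (n : ℕ) (a b : ℝ) where
  graph : SimpleGraph (Fin n)
  connected : graph.Connected
  weight : Sym2 (Fin n) → ℕ
  weight_pos : ∀ e ∈ graph.edgeSet, 1 ≤ weight e
  weight_le : ∀ e ∈ graph.edgeSet, (weight e : ℝ) ≤ (n : ℝ) ^ b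
  /-- Only edges carry a weight. -/
  weight_off : ∀ e, e ∉ graph.edgeSet → weight e = 0
  label : Fin n → List Bool
  id : Fin n → ℕ
  id_injective : Function.Injective id
  id_pos : ∀ v, 1 ≤ id v
  id_le : ∀ v, (id v : ℝ) ≤ (n : ℝ) ^ a

variable {n : ℕ} {a b : ℝ}

/-- The weighted distance: the least total weight of a walk from `u` to `v`. -/
noncomputable def Inst.wdist (I : Inst n a b) (u v : Fin n) : ℕ :=
  sInf (Set.range fun p : I.graph.Walk u v => (p.edges.map I.weight).sum)

/-- The weighted diameter. -/
noncomputable def Inst.diam (I : Inst n a b) : ℕ :=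
  Finset.univ.sup fun p : Fin n × Fin n => I.wdist p.1 p.2

/-- The predicate DIAM: every label is (the binary representation of) the diameter. -/
def Diam (I : Inst n a b) : Prop :=
  ∀ v, I.label v = Nat.bits I.diam

/-- What a node can learn about its neighbourhood: its own identity, the identities, labels and
certificates of the visible nodes, and the visible edges (as pairs of identities) with their
weights. As identities are distinct, this describes the labeled ball up to isomorphism. -/
structure View where
  center : ℕ
  nodes : Set (ℕ × List Bool × List Bool)
  edges : Set (ℕ × ℕ × ℕ)

/-- The view of radius `t` of the node `v`: the ball of all nodes within `t` hops of `v`, and all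
edges between them. -/
def Inst.view (I : Inst n a b) (t : ℕ) (cert : Fin n → List Bool) (v : Fin n) : View where
  center := I.id v
  nodes := {q | ∃ u, I.graph.dist v u ≤ t ∧ q = (I.id u, I.label u, cert u)}
  edges := {q | ∃ u u', I.graph.dist v u ≤ t ∧ I.graph.dist v u' ≤ t ∧ I.graph.Adj u u' ∧
    q = (I.id u, I.id u', I.weight s(u, u'))}

/-- A proof-labeling scheme of radius at most `t` for the predicate `P` on `n`-node instances:
a prover and a verifier, the latter deciding at each node from the node's view of radius `t`. -/
structure PLS (P : Inst n a b → Prop) (t : ℕ) where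
  prover : Inst n a b → Fin n → List Bool
  verifier : View → Prop
  complete : ∀ I, P I → ∀ v, verifier (I.view t (prover I) v)
  sound : ∀ I, ¬ P I → ∀ cert : Fin n → List Bool, ∃ v, ¬ verifier (I.view t cert v)

/-- The certificate size of a scheme: the maximal length of a certificate that the prover assigns
to a node of an instance satisfying the predicate. -/
noncomputable def PLS.size {P : Inst n a b → Prop} {t : ℕ} (S : PLS P t) : ℕ∞ :=
  ⨆ (I : Inst n a b) (_ : P I) (v : Fin n), ((S.prover I v).length : ℕ∞)

/-- The minimum certificate size of a scheme of radius at most `t` for `P`. -/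
noncomputable def sizePLS (P : Inst n a b → Prop) (t : ℕ) : ℕ∞ :=
  ⨅ S : PLS P t, S.size

/-- The minimum certificate size, over `n`-node instances, of a scheme of radius at most `t` for
DIAM; `a` and `b` are the exponents bounding identities and weights. -/
noncomputable def sizeDiam (a b : ℝ) (n t : ℕ) : ℕ∞ :=
  sizePLS (Diam : Inst n a b → Prop) t

end ProofLabeling

/-!
Upper bound. The diameter is at most `D` if every node can tell, for each of the `n` identities, a
bound `≤ D` on its distance to the node of that identity. Instead of storing all `n` distances, a
node `v` stores its distance to `u` only if its depth in a tree of lightest walks towards `u` is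
congruent to `r u` modulo `t`. Following the tree for at most `t` hops, `v` then sees `u` or a node
that stores its distance to `u` (`Inst.exists_ancestor_mod`). An entry is accepted if it is
witnessed by a visible walk to the source, or by a smaller entry elsewhere, so accepted entries are
true upper bounds by induction on their value (`Inst.entry_valid`). Averaging `∑ v, 2 ^ load v` over
`r` gives residues for which each node stores only `O(log n + n / t)` entries (`exists_balanced`).
That the diameter is at least `D` is certified by a potential that changes along an edge by at most
its weight, vanishes somewhere, and reaches `D` somewhere; the two places are found by descent.

Lower bound. For inputs `x` and `y` of `2 ^ m` bits, a ladder with `2 * t + 1` rungs, each a clique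
of `2 * m + 2` nodes, joins `2 ^ m` left nodes, attached depending on `x`, to `2 ^ m` right nodes,
attached depending on `y`. A left and a right node are at distance `2 * t + 2` if they are attached
to a common rail, and farther apart otherwise. The rails encode binary expansions and their
complements, so nodes of different indices always share one; those of index `i` do iff `x i` or
`y i` holds. Hence the instances for `x` and its complement have diameter `2 * t + 2`. If two of
them got the same certificates on the rungs, no node could tell them apart from an instance that
has the left side of one and the right side of the other; but one of the two mixed instances has a
larger diameter (`rungs_distinguish`). So the certificates on the `O(m t)` nodes of the rungs take
`2 ^ 2 ^ m` values (`two_pow_le_size`), and `m ≈ log₂ n` gives the claim.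

The scaling statement combines the upper bound for `t` with the lower bound for radius `1`.
-/

namespace ProofLabeling

variable {n : ℕ} {a b : ℝ}

/-! ### Weighted distances -/

theorem bits_injective : Function.Injective Nat.bits := fun x y h =>
  Nat.eq_of_testBit_eq fun i => by rw [Nat.testBit_eq_inth, Nat.testBit_eq_inth, h]

/-- The total weight of a walk. -/
def Inst.walkWeight (I : Inst n a b) {u v : Fin n} (p : I.graph.Walk u v) : ℕ :=
  (p.edges.map I.weight).sum

@[simp]
theorem Inst.walkWeight_nil (I : Inst n a b) (u : Fin n) :
    I.walkWeight (SimpleGraph.Walk.nil : I.graph.Walk u u) = 0 := by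
  simp [walkWeight]

@[simp]
theorem Inst.walkWeight_cons (I : Inst n a b) {u v w : Fin n} (h : I.graph.Adj u v)
    (p : I.graph.Walk v w) :
    I.walkWeight (SimpleGraph.Walk.cons h p) = I.weight s(u, v) + I.walkWeight p := by
  simp [walkWeight]

theorem Inst.weight_pos_of_adj (I : Inst n a b) {u v : Fin n} (h : I.graph.Adj u v) :
    1 ≤ I.weight s(u, v) :=
  I.weight_pos _ ((SimpleGraph.mem_edgeSet _).2 h)

theorem Inst.length_le_walkWeight (I : Inst n a b) {u v : Fin n} (p : I.graph.Walk u v) :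
    p.length ≤ I.walkWeight p := by
  induction p with
  | nil => simp
  | cons h p ih =>
    have := I.weight_pos_of_adj h
    simp only [SimpleGraph.Walk.length_cons, walkWeight_cons]
    omega

theorem Inst.wdist_le (I : Inst n a b) {u v : Fin n} (p : I.graph.Walk u v) :
    I.wdist u v ≤ I.walkWeight p :=
  Nat.sInf_le ⟨p, rfl⟩

theorem Inst.exists_walkWeight_eq (I : Inst n a b) (u v : Fin n) :
    ∃ p : I.graph.Walk u v, I.walkWeight p = I.wdist u v := by
  obtain ⟨p⟩ := I.connected.preconnected u v
  exact Nat.sInf_mem (s := Set.range fun p : I.graph.Walk u v => (p.edges.map I.weight).sum)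
    ⟨_, p, rfl⟩

@[simp]
theorem Inst.wdist_self (I : Inst n a b) (u : Fin n) : I.wdist u u = 0 := by
  have := I.wdist_le (SimpleGraph.Walk.nil : I.graph.Walk u u)
  simpa using this

theorem Inst.wdist_le_weight_add (I : Inst n a b) {u v : Fin n} (h : I.graph.Adj u v)
    (w : Fin n) : I.wdist u w ≤ I.weight s(u, v) + I.wdist v w := by
  obtain ⟨p, hp⟩ := I.exists_walkWeight_eq v w
  rw [← hp, ← I.walkWeight_cons h p]
  exact I.wdist_le _

theorem Inst.wdist_triangle (I : Inst n a b) (u v w : Fin n) :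
    I.wdist u w ≤ I.wdist u v + I.wdist v w := by
  obtain ⟨p, hp⟩ := I.exists_walkWeight_eq u v
  obtain ⟨q, hq⟩ := I.exists_walkWeight_eq v w
  have := I.wdist_le (p.append q)
  rw [← hp, ← hq]
  simpa [walkWeight, SimpleGraph.Walk.edges_append] using this

theorem Inst.wdist_le_diam (I : Inst n a b) (u v : Fin n) : I.wdist u v ≤ I.diam :=
  Finset.le_sup (f := fun p : Fin n × Fin n => I.wdist p.1 p.2) (Finset.mem_univ (u, v))

theorem Inst.exists_wdist_eq_diam (I : Inst n a b) : ∃ u v, I.wdist u v = I.diam := by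
  obtain ⟨x⟩ := I.connected.nonempty
  obtain ⟨p, -, hp⟩ := Finset.exists_mem_eq_sup Finset.univ ⟨(x, x), Finset.mem_univ _⟩
    (fun p : Fin n × Fin n => I.wdist p.1 p.2)
  exact ⟨p.1, p.2, hp.symm⟩

/-- A function that grows along each edge by at most the weight of the edge bounds distances from
below. -/
theorem Inst.le_add_wdist (I : Inst n a b) (f : Fin n → ℕ)
    (hf : ∀ u v, I.graph.Adj u v → f u ≤ f v + I.weight s(u, v)) (u v : Fin n) :
    f u ≤ f v + I.wdist u v := by
  obtain ⟨p, hp⟩ := I.exists_walkWeight_eq u v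
  rw [← hp]
  clear hp
  induction p with
  | nil => simp
  | cons h p ih =>
    have := hf _ _ h
    rw [I.walkWeight_cons]
    omega

/-- Distances are at most `n * n ^ b`, since a lightest walk is no heavier than a path. -/
theorem Inst.wdist_le_pow (I : Inst n a b) (u v : Fin n) :
    (I.wdist u v : ℝ) ≤ n * (n : ℝ) ^ b := by
  classical
  obtain ⟨q⟩ := I.connected.preconnected u v
  have key : ∀ {u v : Fin n} (p : I.graph.Walk u v),
      (I.walkWeight p : ℝ) ≤ p.length * (n : ℝ) ^ b := by
    intro u v p
    induction p with
    | nil => simp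
    | cons h p ih =>
      have := I.weight_le _ ((SimpleGraph.mem_edgeSet _).2 h)
      rw [I.walkWeight_cons, SimpleGraph.Walk.length_cons]
      push_cast
      linarith
  have hlt : q.bypass.length < n := by
    simpa using (q.bypass_isPath).length_lt
  calc (I.wdist u v : ℝ) ≤ I.walkWeight q.bypass := by exact_mod_cast I.wdist_le _
    _ ≤ q.bypass.length * (n : ℝ) ^ b := key _
    _ ≤ n * (n : ℝ) ^ b := by gcongr

/-- The least number of hops of a lightest walk from `v` to `u`, that is, the depth of `v` in a
tree of lightest walks towards `u`. -/
noncomputable def Inst.depth (I : Inst n a b) (u v : Fin n) : ℕ :=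
  sInf {k | ∃ p : I.graph.Walk v u, I.walkWeight p = I.wdist v u ∧ p.length = k}

/-- Every node other than `u` has a parent in the tree of lightest walks towards `u`. -/
theorem Inst.exists_parent (I : Inst n a b) {u v : Fin n} (huv : v ≠ u) :
    ∃ v', I.graph.Adj v v' ∧ I.weight s(v, v') + I.wdist v' u = I.wdist v u ∧
      I.depth u v = I.depth u v' + 1 := by
  have hmem : ∀ x, I.depth u x ∈
      {k | ∃ p : I.graph.Walk x u, I.walkWeight p = I.wdist x u ∧ p.length = k} := fun x => by
    obtain ⟨p, hp⟩ := I.exists_walkWeight_eq x u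
    exact Nat.sInf_mem ⟨_, p, hp, rfl⟩
  obtain ⟨p, hp, hl⟩ := hmem v
  cases p with
  | nil => exact absurd rfl huv
  | @cons _ v' _ h q =>
    rw [I.walkWeight_cons] at hp
    rw [SimpleGraph.Walk.length_cons] at hl
    have h1 := I.wdist_le_weight_add h u
    have h2 := I.wdist_le q
    refine ⟨v', h, by omega, ?_⟩
    have h3 : I.depth u v' ≤ q.length := Nat.sInf_le ⟨q, by omega, rfl⟩
    obtain ⟨q', hq', hl'⟩ := hmem v'
    have h4 : I.depth u v ≤ I.depth u v' + 1 :=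
      Nat.sInf_le ⟨SimpleGraph.Walk.cons h q', by rw [I.walkWeight_cons]; omega,
        by rw [SimpleGraph.Walk.length_cons, hl']⟩
    omega

theorem Inst.exists_adj_wdist_lt (I : Inst n a b) {u v : Fin n} (huv : v ≠ u) :
    ∃ v', I.graph.Adj v v' ∧ I.wdist v' u < I.wdist v u := by
  obtain ⟨v', h, h1, -⟩ := I.exists_parent huv
  have := I.weight_pos_of_adj h
  exact ⟨v', h, by omega⟩

/-- Following parents for `j` hops. -/
theorem Inst.exists_ancestor (I : Inst n a b) (u : Fin n) (j : ℕ) (v : Fin n)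
    (hj : j ≤ I.depth u v) :
    ∃ (w : Fin n) (q : I.graph.Walk v w), q.length = j ∧
      I.walkWeight q + I.wdist w u = I.wdist v u ∧ I.depth u w + j = I.depth u v := by
  induction j generalizing v with
  | zero => exact ⟨v, SimpleGraph.Walk.nil, by simp⟩
  | succ j ih =>
    have huv : v ≠ u := by
      rintro rfl
      have : I.depth v v ≤ 0 := Nat.sInf_le ⟨SimpleGraph.Walk.nil, by simp⟩
      omega
    obtain ⟨v', h, h1, h2⟩ := I.exists_parent huv
    obtain ⟨w, q, hq, hw, hd⟩ := ih v' (by omega)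
    refine ⟨w, SimpleGraph.Walk.cons h q, by simp [hq], ?_, by omega⟩
    rw [I.walkWeight_cons]
    omega

/-- Among any `t` consecutive ancestors of `v`, either the root `u` appears, or all residues of
the depth modulo `t` do. -/
theorem Inst.exists_ancestor_mod (I : Inst n a b) {t r : ℕ} (hr : r < t) (u v : Fin n) :
    ∃ (w : Fin n) (q : I.graph.Walk v w), q.length ≤ t ∧
      I.walkWeight q + I.wdist w u = I.wdist v u ∧
      (w = u ∨ I.depth u w % t = r ∧ I.wdist w u < I.wdist v u) := by
  by_cases hd : I.depth u v ≤ t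
  · obtain ⟨w, q, hq, hw, h0⟩ := I.exists_ancestor u _ v le_rfl
    refine ⟨w, q, by omega, hw, Or.inl ?_⟩
    by_contra hwu
    obtain ⟨w', -, -, h⟩ := I.exists_parent hwu
    omega
  · have hdiv := Nat.div_add_mod (I.depth u v - 1 - r) t
    have hlt := Nat.mod_lt (I.depth u v - 1 - r) (show 0 < t by omega)
    obtain ⟨w, q, hq, hw, h0⟩ := I.exists_ancestor u
      (1 + (I.depth u v - 1 - r) % t) v (by omega)
    refine ⟨w, q, by omega, hw, Or.inr ⟨?_, ?_⟩⟩
    · have : I.depth u w = r + t * ((I.depth u v - 1 - r) / t) := by omega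
      rw [this, Nat.add_mul_mod_self_left, Nat.mod_eq_of_lt hr]
    · have := I.length_le_walkWeight q
      omega

/-! ### The verifier -/

/-- The content of a certificate: a set of pairs of an identity and a bound on the distance to the
node of that identity, and two heights. The first height certifies a lower bound on the diameter,
the second one leads to a node at which the first one is large. -/
structure Cert where
  entries : Set (ℕ × ℕ)
  height : ℕ
  guide : ℕ

/-- In the view there is a walk of weight `d` between the nodes with the given identities. -/
inductive View.Reach (V : View) : ℕ → ℕ → ℕ → Prop
  | refl (i : ℕ) : View.Reach V i i 0
  | cons {i j k w d : ℕ} : (i, j, w) ∈ V.edges → View.Reach V j k d → View.Reach V i k (w + d)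

/-- The node with identity `i` carries a certificate that decodes to `c`. -/
def View.HasCert (V : View) (dec : List Bool → Cert) (i : ℕ) (c : Cert) : Prop :=
  ∃ l s, (i, l, s) ∈ V.nodes ∧ dec s = c

/-- The center can tell that the node with identity `i` is at distance at most `e`: it sees a walk
to it, or to a node that has an entry for it. -/
def View.Known (V : View) (dec : List Bool → Cert) (i e : ℕ) : Prop :=
  V.Reach V.center i e ∨
    ∃ j c d d', V.HasCert dec j c ∧ V.Reach V.center j d ∧ (i, d') ∈ c.entries ∧ d + d' = e

/-- The neighbour of the center with identity `j` carries the certificate `c`, and the edge to it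
has weight `w`. -/
def View.Neighbor (V : View) (dec : List Bool → Cert) (j w : ℕ) (c : Cert) : Prop :=
  (V.center, j, w) ∈ V.edges ∧ V.HasCert dec j c

/-- The conditions that the verifier checks against the claimed diameter `D`. -/
structure View.Accepts (V : View) (dec : List Bool → Cert) (n D : ℕ) : Prop where
  label : ∀ q ∈ V.nodes, q.2.1 = Nat.bits D
  /-- Each entry is witnessed by a visible walk, or by a smaller entry elsewhere. -/
  entry : ∀ c, V.HasCert dec V.center c → ∀ i d, (i, d) ∈ c.entries →
    (∃ d' ≤ d, V.Reach V.center i d') ∨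
      ∃ j c' e d', V.HasCert dec j c' ∧ V.Reach V.center j e ∧ (i, d') ∈ c'.entries ∧
        e + d' ≤ d ∧ d' < d
  /-- All `n` nodes are within distance `D`. -/
  all_known : ∃ s : Finset ℕ, s.card = n ∧ ∀ i ∈ s, ∃ e ≤ D, V.Known dec i e
  height_le : ∀ c, V.HasCert dec V.center c → ∀ j w c', V.Neighbor dec j w c' →
    c.height ≤ c'.height + w
  height_desc : ∀ c, V.HasCert dec V.center c →
    c.height = 0 ∨ ∃ j w c', V.Neighbor dec j w c' ∧ c'.height < c.height
  guide_desc : ∀ c, V.HasCert dec V.center c →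
    D ≤ c.height ∨ ∃ j w c', V.Neighbor dec j w c' ∧ c'.guide < c.guide

variable {t : ℕ}

theorem Inst.hasCert_view (I : Inst n a b) {cert : Fin n → List Bool}
    {dec : List Bool → Cert} {v : Fin n} {i : ℕ} {c : Cert} :
    (I.view t cert v).HasCert dec i c ↔
      ∃ u, I.graph.dist v u ≤ t ∧ I.id u = i ∧ dec (cert u) = c := by
  constructor
  · rintro ⟨l, s, ⟨u, hu, h⟩, rfl⟩
    simp only [Prod.mk.injEq] at h
    obtain ⟨rfl, -, rfl⟩ := h
    exact ⟨u, hu, rfl, rfl⟩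
  · rintro ⟨u, hu, rfl, rfl⟩
    exact ⟨_, _, ⟨u, hu, rfl⟩, rfl⟩

theorem Inst.hasCert_view_center (I : Inst n a b) {cert : Fin n → List Bool}
    {dec : List Bool → Cert} {v : Fin n} {c : Cert} :
    (I.view t cert v).HasCert dec (I.id v) c ↔ dec (cert v) = c := by
  rw [I.hasCert_view]
  constructor
  · rintro ⟨u, -, hu, rfl⟩
    rw [I.id_injective hu]
  · rintro rfl
    exact ⟨v, by simp, rfl, rfl⟩

theorem Inst.neighbor_view (I : Inst n a b) (ht : 1 ≤ t) {cert : Fin n → List Bool}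
    {dec : List Bool → Cert} {v : Fin n} {j w : ℕ} {c : Cert} :
    (I.view t cert v).Neighbor dec j w c ↔
      ∃ u, I.graph.Adj v u ∧ I.id u = j ∧ I.weight s(v, u) = w ∧ dec (cert u) = c := by
  rw [View.Neighbor, I.hasCert_view]
  constructor
  · rintro ⟨⟨u, u', -, -, h, he⟩, x, -, hx, rfl⟩
    simp only [Prod.mk.injEq] at he
    obtain ⟨h1, rfl, rfl⟩ := he
    obtain rfl : v = u := I.id_injective h1
    obtain rfl := I.id_injective hx
    exact ⟨x, h, rfl, rfl, rfl⟩
  · rintro ⟨u, h, rfl, rfl, rfl⟩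
    have hd : I.graph.dist v u ≤ t := by
      rw [SimpleGraph.dist_eq_one_iff_adj.2 h]
      exact ht
    exact ⟨⟨v, u, by simp, hd, h, rfl⟩, u, hd, rfl, rfl⟩

theorem Inst.exists_of_reach (I : Inst n a b) {cert : Fin n → List Bool} {v : Fin n} {i j d : ℕ}
    (h : (I.view t cert v).Reach i j d) :
    ∀ u, I.id u = i → ∃ w, I.id w = j ∧ I.wdist u w ≤ d := by
  induction h with
  | refl i => exact fun u hu => ⟨u, hu, by simp⟩
  | cons he _ ih =>
    intro u hu
    obtain ⟨x, x', -, -, hadj, hx⟩ := he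
    simp only [Prod.mk.injEq] at hx
    obtain ⟨rfl, rfl, rfl⟩ := hx
    obtain rfl := I.id_injective hu
    obtain ⟨w, hw, hd⟩ := ih x' rfl
    exact ⟨w, hw, (I.wdist_le_weight_add hadj w).trans (by omega)⟩

theorem Inst.reach_of_walk (I : Inst n a b) {cert : Fin n → List Bool} {v u w : Fin n}
    (p : I.graph.Walk u w) (hp : I.graph.dist v u + p.length ≤ t) :
    (I.view t cert v).Reach (I.id u) (I.id w) (I.walkWeight p) := by
  induction p with
  | nil => exact .refl _
  | @cons x y _ h p ih =>
    rw [SimpleGraph.Walk.length_cons] at hp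
    have h1 := I.connected.dist_triangle (u := v) (v := x) (w := y)
    rw [SimpleGraph.dist_eq_one_iff_adj.2 h] at h1
    rw [I.walkWeight_cons]
    exact .cons ⟨x, y, by omega, by omega, h, rfl⟩ (ih (by omega))

/-- If all nodes accept, then each entry is a true upper bound on a distance. -/
theorem Inst.entry_valid (I : Inst n a b) {cert : Fin n → List Bool} {dec : List Bool → Cert}
    {D : Fin n → ℕ} (h : ∀ v, (I.view t cert v).Accepts dec n (D v)) (d i : ℕ) (v : Fin n)
    (hd : (i, d) ∈ (dec (cert v)).entries) : ∃ u, I.id u = i ∧ I.wdist v u ≤ d := by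
  induction d using Nat.strong_induction_on generalizing v with
  | _ d ih =>
    rcases (h v).entry _ (I.hasCert_view_center.2 rfl) i d hd with
      ⟨d', hd', hr⟩ | ⟨j, c, e, d', hc, hr, hmem, hle, hlt⟩
    · obtain ⟨u, hu, hw⟩ := I.exists_of_reach hr v rfl
      exact ⟨u, hu, hw.trans hd'⟩
    · obtain ⟨x, -, rfl, rfl⟩ := I.hasCert_view.1 hc
      obtain ⟨x', hx', hw⟩ := I.exists_of_reach hr v rfl
      obtain rfl := I.id_injective hx'
      obtain ⟨u, hu, hu'⟩ := ih d' hlt x' hmem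
      exact ⟨u, hu, (I.wdist_triangle v x' u).trans (by omega)⟩

/-- Soundness: if all nodes accept, then all labels are the diameter. -/
theorem Inst.diam_of_accepts (I : Inst n a b) (ht : 1 ≤ t) {cert : Fin n → List Bool}
    {dec : List Bool → Cert} (h : ∀ v, ∃ D, (I.view t cert v).Accepts dec n D) : Diam I := by
  choose D hD using h
  have hlabel : ∀ v, I.label v = Nat.bits (D v) := fun v =>
    (hD v).label _ ⟨v, by simp, rfl⟩
  have hconst : ∀ {u v : Fin n}, I.graph.Walk u v → D u = D v := by
    intro u v p
    induction p with
    | nil => rfl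
    | @cons x y _ hadj p ih =>
      rw [← ih]
      have h1 : I.label y = Nat.bits (D x) := (hD x).label _
        ⟨y, by rw [SimpleGraph.dist_eq_one_iff_adj.2 hadj]; exact ht, rfl⟩
      exact bits_injective (h1.symm.trans (hlabel y))
  have hconst' : ∀ u v, D u = D v := fun u v => hconst (I.connected.preconnected u v).some
  have hupper : ∀ u v, I.wdist u v ≤ D u := by
    intro u v
    obtain ⟨s, hs, hknown⟩ := (hD u).all_known
    have hex : ∀ i ∈ s, ∃ w, I.id w = i ∧ I.wdist u w ≤ D u := by
      intro i hi
      obtain ⟨e, he, hr | ⟨j, c, d, d', hc, hr, hmem, rfl⟩⟩ := hknown i hi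
      · obtain ⟨w, hw, hle⟩ := I.exists_of_reach hr u rfl
        exact ⟨w, hw, hle.trans he⟩
      · obtain ⟨x, -, rfl, rfl⟩ := I.hasCert_view.1 hc
        obtain ⟨x', hx', hw⟩ := I.exists_of_reach hr u rfl
        obtain rfl := I.id_injective hx'
        obtain ⟨w, hw', hle⟩ := I.entry_valid hD d' i x' hmem
        exact ⟨w, hw', (I.wdist_triangle u x' w).trans (by omega)⟩
    have hsub : s ⊆ Finset.univ.image I.id := by
      intro i hi
      obtain ⟨w, hw, -⟩ := hex i hi
      exact Finset.mem_image.2 ⟨w, Finset.mem_univ _, hw⟩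
    have heq : s = Finset.univ.image I.id := by
      refine Finset.eq_of_subset_of_card_le hsub ?_
      rw [Finset.card_image_of_injective _ I.id_injective, hs]
      simp
    obtain ⟨w, hw, hle⟩ := hex (I.id v) (heq ▸ Finset.mem_image_of_mem _ (Finset.mem_univ v))
    rwa [I.id_injective hw] at hle
  have hzero : ∀ k v, (dec (cert v)).height = k → ∃ u, (dec (cert u)).height = 0 := by
    intro k
    induction k using Nat.strong_induction_on with
    | _ k ih =>
      intro v hv
      rcases (hD v).height_desc _ (I.hasCert_view_center.2 rfl) with h0 | ⟨j, w, c, hn, hlt⟩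
      · exact ⟨v, h0⟩
      · obtain ⟨x, -, -, -, rfl⟩ := (I.neighbor_view ht).1 hn
        exact ih _ (hv ▸ hlt) x rfl
  have htop : ∀ k v, (dec (cert v)).guide = k → ∃ u, D u ≤ (dec (cert u)).height := by
    intro k
    induction k using Nat.strong_induction_on with
    | _ k ih =>
      intro v hv
      rcases (hD v).guide_desc _ (I.hasCert_view_center.2 rfl) with h0 | ⟨j, w, c, hn, hlt⟩
      · exact ⟨v, h0⟩
      · obtain ⟨x, -, -, -, rfl⟩ := (I.neighbor_view ht).1 hn
        exact ih _ (hv ▸ hlt) x rfl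
  intro v
  obtain ⟨u₀, hu₀⟩ := hzero _ v rfl
  obtain ⟨v₀, hv₀⟩ := htop _ v rfl
  have hlower := I.le_add_wdist (fun v => (dec (cert v)).height) (fun x y hxy =>
    (hD x).height_le _ (I.hasCert_view_center.2 rfl) _ _ _
      ((I.neighbor_view ht).2 ⟨y, hxy, rfl, rfl, rfl⟩)) v₀ u₀
  have h1 := I.wdist_le_diam v₀ u₀
  have h2 : I.diam ≤ D v := Finset.sup_le fun p _ => (hupper p.1 p.2).trans (hconst' _ _).le
  have h3 := hconst' v v₀
  rw [hlabel v]
  congr 1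
  omega

/-- Completeness: the certificates that store at `v` the distance to each node `u` for which the
depth of `v` has the residue `r u` modulo `t`. -/
theorem Inst.accepts_of_diam (I : Inst n a b) (hI : Diam I) (ht : 1 ≤ t)
    {cert : Fin n → List Bool} {dec : List Bool → Cert} {r : Fin n → Fin t} {u₀ v₀ : Fin n}
    (h₀ : I.wdist v₀ u₀ = I.diam)
    (hcert : ∀ v, dec (cert v) =
      ⟨{q | ∃ u, I.depth u v % t = r u ∧ q = (I.id u, I.wdist v u)}, I.wdist v u₀, I.wdist v v₀⟩)
    (v : Fin n) : (I.view t cert v).Accepts dec n I.diam := by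
  have hreach : ∀ {w} (q : I.graph.Walk v w), q.length ≤ t →
      (I.view t cert v).Reach (I.view t cert v).center (I.id w) (I.walkWeight q) :=
    fun q hq => I.reach_of_walk q (by simpa using hq)
  have hhas : ∀ {w} (q : I.graph.Walk v w), q.length ≤ t →
      (I.view t cert v).HasCert dec (I.id w) (dec (cert w)) :=
    fun q hq => I.hasCert_view.2 ⟨_, (SimpleGraph.dist_le q).trans hq, rfl, rfl⟩
  refine ⟨?_, ?_, ?_, ?_, ?_, ?_⟩
  · rintro _ ⟨u, -, rfl⟩
    exact hI u
  · intro c hc i d hid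
    obtain rfl := I.hasCert_view_center.1 hc
    rw [hcert] at hid
    obtain ⟨u, hu, hud⟩ := hid
    simp only [Prod.mk.injEq] at hud
    obtain ⟨rfl, rfl⟩ := hud
    obtain ⟨w, q, hq, hw, rfl | ⟨hmod, hlt⟩⟩ := I.exists_ancestor_mod (r u).2 u v
    · exact Or.inl ⟨_, by omega, hreach q hq⟩
    · exact Or.inr ⟨I.id w, dec (cert w), _, I.wdist w u, hhas q hq, hreach q hq,
        by rw [hcert]; exact ⟨u, hmod, rfl⟩, hw.le, hlt⟩
  · refine ⟨Finset.univ.image I.id, ?_, ?_⟩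
    · rw [Finset.card_image_of_injective _ I.id_injective]
      simp
    · intro i hi
      obtain ⟨u, -, rfl⟩ := Finset.mem_image.1 hi
      refine ⟨I.wdist v u, I.wdist_le_diam v u, ?_⟩
      obtain ⟨w, q, hq, hw, rfl | ⟨hmod, hlt⟩⟩ := I.exists_ancestor_mod (r u).2 u v
      · rw [← hw, I.wdist_self, add_zero]
        exact Or.inl (hreach q hq)
      · exact Or.inr ⟨I.id w, dec (cert w), _, I.wdist w u, hhas q hq, hreach q hq,
          by rw [hcert]; exact ⟨u, hmod, rfl⟩, hw⟩
  · intro c hc j w c' hn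
    obtain rfl := I.hasCert_view_center.1 hc
    obtain ⟨u, hadj, rfl, rfl, rfl⟩ := (I.neighbor_view ht).1 hn
    rw [hcert, hcert, add_comm]
    exact I.wdist_le_weight_add hadj u₀
  · intro c hc
    obtain rfl := I.hasCert_view_center.1 hc
    by_cases hv : v = u₀
    · left
      simp [hcert, hv]
    · obtain ⟨x, hadj, hlt⟩ := I.exists_adj_wdist_lt hv
      exact Or.inr ⟨_, _, _, (I.neighbor_view ht).2 ⟨x, hadj, rfl, rfl, rfl⟩,
        by simpa only [hcert] using hlt⟩
  · intro c hc
    obtain rfl := I.hasCert_view_center.1 hc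
    by_cases hv : v = v₀
    · left
      simp [hcert, hv, h₀]
    · obtain ⟨x, hadj, hlt⟩ := I.exists_adj_wdist_lt hv
      exact Or.inr ⟨_, _, _, (I.neighbor_view ht).2 ⟨x, hadj, rfl, rfl, rfl⟩,
        by simpa only [hcert] using hlt⟩

/-! ### Spreading the entries -/

/-- Averaging `∑ v, 2 ^ load v` over all choices of residues gives residues for which no node
stores many entries. -/
theorem exists_balanced {n t : ℕ} (ht : 0 < t) (φ : Fin n → Fin n → Fin t) :
    ∃ r : Fin n → Fin t, ∀ v,
      t ^ n * 2 ^ (Finset.univ.filter fun u => φ u v = r u).card ≤ n * (t + 1) ^ n := by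
  have hsum : ∑ r : Fin n → Fin t, ∑ v,
      2 ^ (Finset.univ.filter fun u => φ u v = r u).card = n * (t + 1) ^ n := by
    rw [Finset.sum_comm]
    have : ∀ v, ∑ r : Fin n → Fin t, 2 ^ (Finset.univ.filter fun u => φ u v = r u).card =
        (t + 1) ^ n := by
      intro v
      have h1 : ∀ r : Fin n → Fin t, 2 ^ (Finset.univ.filter fun u => φ u v = r u).card =
          ∏ u, (1 + if φ u v = r u then 1 else 0) := by
        intro r
        rw [Finset.card_filter, ← Finset.prod_pow_eq_pow_sum]
        exact Finset.prod_congr rfl fun u _ => by split_ifs <;> rfl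
      simp_rw [h1]
      rw [← Fintype.piFinset_univ, ← Finset.prod_univ_sum (fun _ => Finset.univ)
        (fun u s => 1 + if φ u v = s then 1 else 0)]
      simp [Finset.sum_add_distrib]
    simp [this]
  by_contra! hcon
  choose v hv using hcon
  have hlt : ∀ r : Fin n → Fin t, n * (t + 1) ^ n <
      t ^ n * ∑ v, 2 ^ (Finset.univ.filter fun u => φ u v = r u).card := fun r =>
    (hv r).trans_le (Nat.mul_le_mul_left _ (Finset.single_le_sum
      (f := fun v => 2 ^ (Finset.univ.filter fun u => φ u v = r u).card)
      (fun _ _ => Nat.zero_le _) (Finset.mem_univ _)))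
  have hne : (Finset.univ : Finset (Fin n → Fin t)).Nonempty :=
    ⟨fun _ => ⟨0, ht⟩, Finset.mem_univ _⟩
  have hlt' := Finset.sum_lt_sum_of_nonempty hne (fun r _ => hlt r)
  have hsum' : ∑ r : Fin n → Fin t,
      t ^ n * ∑ v, 2 ^ (Finset.univ.filter fun u => φ u v = r u).card =
        t ^ n * (n * (t + 1) ^ n) := by
    rw [← hsum, Finset.mul_sum]
  rw [hsum'] at hlt'
  simp at hlt'

/-! ### The ladder graph -/

section Ladder

variable {κ X Y : Type*} {P : ℕ}

/-- The ladder. Its rungs are `P + 1` cliques on the set `κ` of rails; node `(p, s)` of rung `s`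
is joined to `(p, s + 1)`. A further node `i : X` is joined to the nodes `(p, 0)` with `A i p`, and
a node `i : Y` to the nodes `(p, P)` with `B i p`. -/
inductive LadderAdj (A : X → κ → Prop) (B : Y → κ → Prop) :
    X ⊕ (κ × Fin (P + 1)) ⊕ Y → X ⊕ (κ × Fin (P + 1)) ⊕ Y → Prop
  | left {i p} (s : Fin (P + 1)) : s.1 = 0 → A i p →
      LadderAdj A B (.inl i) (.inr (.inl (p, s)))
  | right {i p} (s : Fin (P + 1)) : s.1 = P → B i p →
      LadderAdj A B (.inr (.inl (p, s))) (.inr (.inr i))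
  | rail (p) (s s' : Fin (P + 1)) : s'.1 = s.1 + 1 →
      LadderAdj A B (.inr (.inl (p, s))) (.inr (.inl (p, s')))
  | rung (p q) (s : Fin (P + 1)) :
      LadderAdj A B (.inr (.inl (p, s))) (.inr (.inl (q, s)))

/-- The graph of `LadderAdj`. -/
def ladder (P : ℕ) (A : X → κ → Prop) (B : Y → κ → Prop) :
    SimpleGraph (X ⊕ (κ × Fin (P + 1)) ⊕ Y) :=
  SimpleGraph.fromRel (LadderAdj A B)

/-- The level of a node: `0` on the left, `s + 1` on rung `s`, `P + 2` on the right. -/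
def ladderLevel : X ⊕ (κ × Fin (P + 1)) ⊕ Y → ℕ
  | .inl _ => 0
  | .inr (.inl (_, s)) => s + 1
  | .inr (.inr _) => P + 2

/-- There is a walk of at most `d` steps from `u` to `v`. -/
def Within {V : Type*} (G : SimpleGraph V) (d : ℕ) (u v : V) : Prop :=
  ∃ p : G.Walk u v, p.length ≤ d

theorem Within.symm {V : Type*} {G : SimpleGraph V} {d : ℕ} {u v : V} (h : Within G d u v) :
    Within G d v u :=
  let ⟨p, hp⟩ := h
  ⟨p.reverse, by simpa using hp⟩

theorem Within.trans {V : Type*} {G : SimpleGraph V} {d e f : ℕ} {u v w : V}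
    (h : Within G d u v) (h' : Within G e v w) (hf : d + e ≤ f) : Within G f u w :=
  let ⟨p, hp⟩ := h
  let ⟨q, hq⟩ := h'
  ⟨p.append q, by rw [SimpleGraph.Walk.length_append]; omega⟩

theorem within_of_ladderAdj {A : X → κ → Prop} {B : Y → κ → Prop}
    {u v : X ⊕ (κ × Fin (P + 1)) ⊕ Y} (h : LadderAdj A B u v) : Within (ladder P A B) 1 u v := by
  by_cases huv : u = v
  · subst huv
    exact ⟨.nil, by simp⟩
  · exact ⟨.cons (show (ladder P A B).Adj u v from ⟨huv, Or.inl h⟩) .nil, by simp⟩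

theorem within_rail {A : X → κ → Prop} {B : Y → κ → Prop} (p : κ) (d : ℕ) (s s' : Fin (P + 1))
    (h : s'.1 = s.1 + d) :
    Within (ladder P A B) d (.inr (.inl (p, s))) (.inr (.inl (p, s'))) := by
  induction d generalizing s' with
  | zero =>
    obtain rfl : s' = s := Fin.ext h
    exact ⟨.nil, by simp⟩
  | succ d ih =>
    exact (ih ⟨s.1 + d, by omega⟩ rfl).trans
      (within_of_ladderAdj (.rail p ⟨s.1 + d, by omega⟩ s' h)) le_rfl

theorem within_rails {A : X → κ → Prop} {B : Y → κ → Prop} (p q : κ) (s s' : Fin (P + 1)) :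
    Within (ladder P A B) (P + 1) (.inr (.inl (p, s))) (.inr (.inl (q, s'))) := by
  rcases le_total s.1 s'.1 with h | h
  · exact (within_rail p (s'.1 - s.1) s s' (by omega)).trans
      (within_of_ladderAdj (.rung p q s')) (by omega)
  · exact (within_of_ladderAdj (.rung p q s)).trans
      (within_rail q (s.1 - s'.1) s' s (by omega)).symm (by omega)

/-- If any left node shares a rail with any right node, then the ladder has diameter at most
`P + 2`. -/
theorem within_ladder {A : X → κ → Prop} {B : Y → κ → Prop} [Nonempty X] [Nonempty Y]
    (hP : 1 ≤ P) (hAB : ∀ i j, ∃ p, A i p ∧ B j p) (u v : X ⊕ (κ × Fin (P + 1)) ⊕ Y) :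
    Within (ladder P A B) (P + 2) u v := by
  have hA : ∀ i, ∃ p, A i p := fun i =>
    let ⟨p, h⟩ := hAB i (Classical.arbitrary Y)
    ⟨p, h.1⟩
  have hB : ∀ i, ∃ p, B i p := fun i =>
    let ⟨p, h⟩ := hAB (Classical.arbitrary X) i
    ⟨p, h.2⟩
  have left : ∀ {i p}, A i p → Within (ladder P A B) 1 (.inl i) (.inr (.inl (p, 0))) :=
    fun h => within_of_ladderAdj (.left 0 rfl h)
  have right : ∀ {i p}, B i p →
      Within (ladder P A B) 1 (.inr (.inr i)) (.inr (.inl (p, Fin.last P))) :=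
    fun h => (within_of_ladderAdj (.right (Fin.last P) rfl h)).symm
  have toRail : ∀ w q s, Within (ladder P A B) (P + 2) w (.inr (.inl (q, s))) := by
    rintro (i | ⟨p, s'⟩ | i) q s
    · obtain ⟨p, hp⟩ := hA i
      exact (left hp).trans (within_rails p q 0 s) (by omega)
    · exact (within_rails p q s' s).trans ⟨.nil, le_rfl⟩ (by simp)
    · obtain ⟨p, hp⟩ := hB i
      exact (right hp).trans (within_rails p q _ s) (by omega)
  have across : ∀ i j, Within (ladder P A B) (P + 2) (.inl i) (.inr (.inr j)) := by
    intro i j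
    obtain ⟨p, hi, hj⟩ := hAB i j
    exact ((left hi).trans (within_rail p P 0 (Fin.last P) (by simp)) le_rfl).trans
      (right hj).symm (by omega)
  rcases u with i | ⟨p, s⟩ | i
  · rcases v with j | ⟨q, s'⟩ | j
    · obtain ⟨p, hp⟩ := hA i
      obtain ⟨q, hq⟩ := hA j
      exact ((left hp).trans (within_of_ladderAdj (.rung p q 0)) le_rfl).trans (left hq).symm
        (by omega)
    · exact toRail _ _ _
    · exact across i j
  · exact (toRail _ _ _).symm
  · rcases v with j | ⟨q, s'⟩ | j
    · exact (across j i).symm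
    · exact toRail _ _ _
    · obtain ⟨p, hp⟩ := hB i
      obtain ⟨q, hq⟩ := hB j
      exact ((right hp).trans (within_of_ladderAdj (.rung p q _)) le_rfl).trans (right hq).symm
        (by omega)

/-- The ladder is connected as soon as every outer node is attached to some rail. -/
theorem ladder_connected {A : X → κ → Prop} {B : Y → κ → Prop} [Nonempty κ]
    (hA : ∀ i, ∃ p, A i p) (hB : ∀ i, ∃ p, B i p) : (ladder P A B).Connected := by
  obtain ⟨p₀⟩ := ‹Nonempty κ›
  rw [SimpleGraph.connected_iff_exists_forall_reachable]
  refine ⟨.inr (.inl (p₀, 0)), ?_⟩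
  rintro (i | ⟨p, s⟩ | i)
  · obtain ⟨p, hp⟩ := hA i
    obtain ⟨q, -⟩ := (within_rails (A := A) (B := B) p₀ p 0 0).trans
      (within_of_ladderAdj (.left 0 rfl hp)).symm le_rfl
    exact ⟨q⟩
  · obtain ⟨q, -⟩ := within_rails (A := A) (B := B) p₀ p 0 s
    exact ⟨q⟩
  · obtain ⟨p, hp⟩ := hB i
    obtain ⟨q, -⟩ := (within_rails (A := A) (B := B) p₀ p 0 (Fin.last P)).trans
      (within_of_ladderAdj (.right (Fin.last P) rfl hp)) le_rfl
    exact ⟨q⟩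

theorem le_add_length {V : Type*} {G : SimpleGraph V} {f : V → ℕ}
    (hf : ∀ u v, G.Adj u v → f v ≤ f u + 1) {u v : V} (p : G.Walk u v) :
    f v ≤ f u + p.length := by
  induction p with
  | nil => simp
  | cons h p ih =>
    have := hf _ _ h
    rw [SimpleGraph.Walk.length_cons]
    omega

theorem ladderLevel_le {A : X → κ → Prop} {B : Y → κ → Prop} {u v : X ⊕ (κ × Fin (P + 1)) ⊕ Y}
    (h : (ladder P A B).Adj u v) : ladderLevel v ≤ ladderLevel u + 1 := by
  obtain ⟨-, h | h⟩ := h <;> cases h <;> simp_all [ladderLevel]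

theorem add_two_le_length {A : X → κ → Prop} {B : Y → κ → Prop} {i : X} {j : Y}
    (p : (ladder P A B).Walk (.inl i) (.inr (.inr j))) : P + 2 ≤ p.length := by
  simpa [ladderLevel] using le_add_length (fun _ _ => ladderLevel_le) p

/-- A left and a right node that share no rail are at distance at least `P + 3`, since a walk
between them uses an edge inside a rung. -/
theorem add_three_le_length {A : X → κ → Prop} {B : Y → κ → Prop} {i : X} {j : Y}
    (hij : ∀ p, A i p → ¬ B j p)
    (p : (ladder P A B).Walk (.inl i) (.inr (.inr j))) : P + 3 ≤ p.length := by
  classical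
  -- Being on a rail to which `i` is not attached counts as one further step.
  let f : X ⊕ (κ × Fin (P + 1)) ⊕ Y → ℕ := fun
    | .inl k => if k = i then 0 else 1
    | .inr (.inl (p, s)) => if A i p then s + 1 else s + 2
    | .inr (.inr k) => if k = j then P + 3 else P + 2
  have hf : ∀ u v, LadderAdj A B u v → f v ≤ f u + 1 ∧ f u ≤ f v + 1 := by
    intro u v h
    cases h <;> simp only [f] <;> split_ifs <;> first | omega | (subst_vars; simp_all)
  have := le_add_length (G := ladder P A B) (f := f)
    (fun u v h => h.2.elim (fun h => (hf _ _ h).1) (fun h => (hf _ _ h).2)) p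
  simpa [f] using this

end Ladder

/-! ### Views that agree -/

theorem exists_walk_of_agree {V : Type*} {G G' : SimpleGraph V} {f : V → ℕ} {c : ℕ}
    (hf : ∀ u v, G.Adj u v → f v ≤ f u + 1)
    (h : ∀ u v, f u < c → f v < c → G.Adj u v → G'.Adj u v) {u v : V} (p : G.Walk u v)
    (hp : f u + p.length < c) : ∃ q : G'.Walk u v, q.length = p.length := by
  induction p with
  | nil => exact ⟨.nil, rfl⟩
  | cons e p ih =>
    rw [SimpleGraph.Walk.length_cons] at hp
    have := hf _ _ e
    obtain ⟨q, hq⟩ := ih (by omega)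
    exact ⟨.cons (h _ _ (by omega) (by omega) e) q, by simp [hq]⟩

/-- Two instances that agree on the region `f < c` give the same view to a node from which the
radius `t` does not leave the region. -/
theorem Inst.view_congr {I I' : Inst n a b} {t : ℕ} {cert cert' : Fin n → List Bool}
    {f : Fin n → ℕ} {c : ℕ} {v : Fin n}
    (hf : ∀ u w, I.graph.Adj u w → f w ≤ f u + 1)
    (hf' : ∀ u w, I'.graph.Adj u w → f w ≤ f u + 1)
    (hid : I.id = I'.id) (hlabel : I.label = I'.label)
    (hadj : ∀ u w, f u < c → f w < c → (I.graph.Adj u w ↔ I'.graph.Adj u w))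
    (hweight : ∀ u w, I.graph.Adj u w → I'.graph.Adj u w → I.weight s(u, w) = I'.weight s(u, w))
    (hcert : ∀ u, f u < c → cert u = cert' u) (hv : f v + t < c) :
    I.view t cert v = I'.view t cert' v := by
  have hlt : ∀ u, I.graph.dist v u ≤ t → f u < c := by
    intro u hu
    obtain ⟨p, hp⟩ := I.connected.exists_walk_length_eq_dist v u
    have := le_add_length hf p
    omega
  have hdist : ∀ u, I.graph.dist v u ≤ t ↔ I'.graph.dist v u ≤ t := by
    refine fun u => ⟨fun hu => ?_, fun hu => ?_⟩
    · obtain ⟨p, hp⟩ := I.connected.exists_walk_length_eq_dist v u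
      obtain ⟨q, hq⟩ := exists_walk_of_agree hf (fun u w h1 h2 => (hadj u w h1 h2).1) p (by omega)
      exact (SimpleGraph.dist_le q).trans (by omega)
    · obtain ⟨p, hp⟩ := I'.connected.exists_walk_length_eq_dist v u
      obtain ⟨q, hq⟩ := exists_walk_of_agree hf' (fun u w h1 h2 => (hadj u w h1 h2).2) p (by omega)
      exact (SimpleGraph.dist_le q).trans (by omega)
  simp only [Inst.view, View.mk.injEq]
  refine ⟨by rw [hid], ?_, ?_⟩
  · ext q
    refine ⟨?_, ?_⟩
    · rintro ⟨u, hu, rfl⟩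
      exact ⟨u, (hdist u).1 hu, by rw [hid, hlabel, hcert u (hlt u hu)]⟩
    · rintro ⟨u, hu, rfl⟩
      exact ⟨u, (hdist u).2 hu, by rw [hid, hlabel, hcert u (hlt u ((hdist u).2 hu))]⟩
  · ext q
    refine ⟨?_, ?_⟩
    · rintro ⟨u, w, hu, hw, h, rfl⟩
      have h' := (hadj u w (hlt u hu) (hlt w hw)).1 h
      exact ⟨u, w, (hdist u).1 hu, (hdist w).1 hw, h', by rw [hid, hweight u w h h']⟩
    · rintro ⟨u, w, hu, hw, h', rfl⟩
      rw [← hdist] at hu hw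
      have h := (hadj u w (hlt u hu) (hlt w hw)).2 h'
      exact ⟨u, w, hu, hw, h, by rw [hid, hweight u w h h']⟩

/-! ### Unweighted instances -/

open scoped Classical in
/-- The unweighted instance given by a graph `G` whose nodes are numbered by `e`. All nodes have
the same label. -/
noncomputable def unitInst {V : Type*} (ha : 1 ≤ a) (hb : 0 ≤ b) (e : Fin n ≃ V)
    (G : SimpleGraph V) (hG : G.Connected) (l : List Bool) : Inst n a b where
  graph := G.comap e
  connected := (SimpleGraph.Iso.comap e G).connected_iff.2 hG
  weight s := if s ∈ (G.comap e).edgeSet then 1 else 0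
  weight_pos s hs := by simp [hs]
  weight_le s hs := by
    obtain ⟨x⟩ := hG.nonempty
    have : 1 ≤ n := Nat.succ_le_of_lt (Fin.pos (e.symm x))
    simpa [hs] using Real.one_le_rpow (by exact_mod_cast this) hb
  weight_off s hs := by simp [hs]
  label _ := l
  id v := v + 1
  id_injective v w h := Fin.ext (by simpa using h)
  id_pos v := by simp
  id_le v := by
    have h1 : ((v : ℕ) : ℝ) + 1 ≤ n := by exact_mod_cast v.2
    have h2 : (1 : ℝ) ≤ n := by exact_mod_cast Nat.succ_le_of_lt v.pos
    push_cast
    exact h1.trans (by simpa using Real.rpow_le_rpow_of_exponent_le h2 ha)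

theorem unitInst_wdist_le {V : Type*} (ha : 1 ≤ a) (hb : 0 ≤ b) (e : Fin n ≃ V)
    {G : SimpleGraph V} (hG : G.Connected) (l : List Bool) {d : ℕ} {u v : Fin n}
    (h : Within G d (e u) (e v)) : (unitInst ha hb e G hG l).wdist u v ≤ d := by
  have key : ∀ {u v : Fin n} (p : (G.comap e).Walk u v),
      (unitInst ha hb e G hG l).walkWeight p = p.length := by
    intro u v p
    induction p with
    | nil => rfl
    | @cons x y _ h p ih =>
      have hw : (unitInst ha hb e G hG l).weight s(x, y) = 1 := if_pos h
      refine ((unitInst ha hb e G hG l).walkWeight_cons h p).trans ?_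
      rw [ih, hw, SimpleGraph.Walk.length_cons, add_comm]
  obtain ⟨p, hp⟩ := h
  let q : (G.comap e).Walk u v :=
    (p.map (SimpleGraph.Iso.comap e G).symm.toHom).copy (e.symm_apply_apply u)
      (e.symm_apply_apply v)
  have hq : q.length = p.length :=
    (SimpleGraph.Walk.length_copy _ _ _).trans (SimpleGraph.Walk.length_map _ _)
  refine ((unitInst ha hb e G hG l).wdist_le q).trans ?_
  rw [key, hq]
  exact hp

theorem le_unitInst_wdist {V : Type*} (ha : 1 ≤ a) (hb : 0 ≤ b) (e : Fin n ≃ V)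
    {G : SimpleGraph V} (hG : G.Connected) (l : List Bool) {d : ℕ} {x y : V}
    (h : ∀ p : G.Walk x y, d ≤ p.length) :
    d ≤ (unitInst ha hb e G hG l).wdist (e.symm x) (e.symm y) := by
  obtain ⟨p, hp⟩ := (unitInst ha hb e G hG l).exists_walkWeight_eq (e.symm x) (e.symm y)
  rw [← hp]
  refine le_trans ?_ ((unitInst ha hb e G hG l).length_le_walkWeight p)
  let q : G.Walk x y :=
    (SimpleGraph.Walk.map (SimpleGraph.Iso.comap e G).toHom p).copy (e.apply_symm_apply x)
      (e.apply_symm_apply y)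
  have hq : q.length = p.length :=
    (SimpleGraph.Walk.length_copy _ _ _).trans (SimpleGraph.Walk.length_map _ _)
  rw [← hq]
  exact h q

/-! ### A fooling set for the diameter -/

section Fooling

variable {m k : ℕ}

/-- The rails of the ladder: one for each value of each of `m` bits, and two switched ones. -/
abbrev Rail (m : ℕ) : Type := (Fin m × Bool) ⊕ Bool

/-- The rails to which left nodes are attached. Node `i` is attached to the rails of its own bits,
to one switched rail always, and to the other one if `x i` holds; padding nodes are attached to
all rails. -/
def railLeft (x : (Fin m → Bool) → Bool) : (Fin m → Bool) ⊕ Fin k → Rail m → Prop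
  | .inr _, _ => True
  | .inl i, .inl (j, c) => i j = c
  | .inl i, .inr true => x i = true
  | .inl _, .inr false => True

/-- The rails to which right nodes are attached. Node `i` is attached to the rails of its negated
bits. The roles of the switched rails are exchanged: the one that depends on `x` on the left is
always attached on the right, and the other one is attached if `y i` holds. -/
def railRight (y : (Fin m → Bool) → Bool) : (Fin m → Bool) → Rail m → Prop
  | i, .inl (j, c) => i j ≠ c
  | _, .inr true => True
  | i, .inr false => y i = true

theorem exists_common_rail {x y : (Fin m → Bool) → Bool} (h : ∀ i, x i = true ∨ y i = true)
    (i : (Fin m → Bool) ⊕ Fin k) (j : Fin m → Bool) :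
    ∃ p, railLeft x i p ∧ railRight y j p := by
  rcases i with i | i
  · by_cases hij : i = j
    · subst hij
      rcases h i with h | h
      · exact ⟨.inr true, h, trivial⟩
      · exact ⟨.inr false, trivial, h⟩
    · obtain ⟨l, hl⟩ := Function.ne_iff.1 hij
      exact ⟨.inl (l, i l), rfl, Ne.symm hl⟩
  · exact ⟨.inr true, trivial, trivial⟩

theorem no_common_rail {x y : (Fin m → Bool) → Bool} {i : Fin m → Bool} (hx : x i = false)
    (hy : y i = false) (p : Rail m) (hp : railLeft (k := k) x (.inl i) p) : ¬ railRight y i p := by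
  rcases p with ⟨j, c⟩ | (_ | _) <;> simp_all [railLeft, railRight]

variable (m k) in
/-- The nodes of the ladder with `2 * t + 1` rungs, `2 ^ m` nodes on either side, and `k` padding
nodes. -/
abbrev FoolNode (t : ℕ) : Type :=
  ((Fin m → Bool) ⊕ Fin k) ⊕ (Rail m × Fin (2 * t + 1)) ⊕ (Fin m → Bool)

theorem fool_connected (t : ℕ) (x y : (Fin m → Bool) → Bool) :
    (ladder (2 * t) (railLeft (k := k) x) (railRight y)).Connected := by
  refine ladder_connected ?_ fun i => ⟨.inr true, trivial⟩
  rintro (i | i)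
  exacts [⟨.inr false, trivial⟩, ⟨.inr false, trivial⟩]

/-- The instance in which the left side depends on `x` and the right side on `y`, labelled with
`2 * t + 2`. -/
noncomputable def foolInst (ha : 1 ≤ a) (hb : 0 ≤ b) {t : ℕ} (e : Fin n ≃ FoolNode m k t)
    (x y : (Fin m → Bool) → Bool) : Inst n a b :=
  unitInst ha hb e (ladder (2 * t) (railLeft x) (railRight y)) (fool_connected t x y)
    (Nat.bits (2 * t + 2))

theorem diam_foolInst (ha : 1 ≤ a) (hb : 0 ≤ b) {t : ℕ} (ht : 1 ≤ t)
    (e : Fin n ≃ FoolNode m k t) {x y : (Fin m → Bool) → Bool}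
    (h : ∀ i, x i = true ∨ y i = true) : Diam (foolInst ha hb e x y) := by
  have : (foolInst ha hb e x y).diam = 2 * t + 2 := by
    refine le_antisymm (Finset.sup_le fun p _ => ?_) ?_
    · exact unitInst_wdist_le _ _ _ _ _ (within_ladder (by omega) (exists_common_rail h) _ _)
    · let i : Fin m → Bool := fun _ => true
      exact (le_unitInst_wdist ha hb e (fool_connected t x y) (Nat.bits (2 * t + 2))
        (x := .inl (.inl i)) (y := .inr (.inr i)) add_two_le_length).trans
        (Inst.wdist_le_diam _ _ _)
  intro v
  rw [this]
  rfl

theorem not_diam_foolInst (ha : 1 ≤ a) (hb : 0 ≤ b) {t : ℕ}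
    (e : Fin n ≃ FoolNode m k t) {x y : (Fin m → Bool) → Bool} {i : Fin m → Bool}
    (hx : x i = false) (hy : y i = false) : ¬ Diam (foolInst ha hb e x y) := by
  intro h
  have h1 : 2 * t + 3 ≤ (foolInst ha hb e x y).diam :=
    (le_unitInst_wdist ha hb e (fool_connected t x y) (Nat.bits (2 * t + 2))
      (x := .inl (.inl i)) (y := .inr (.inr i))
      (add_three_le_length (no_common_rail hx hy))).trans (Inst.wdist_le_diam _ _ _)
  have h2 : Nat.bits (2 * t + 2) = Nat.bits (foolInst ha hb e x y).diam :=
    h (e.symm (.inl (.inl i)))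
  have h3 := bits_injective h2
  omega

end Fooling

/-! ### The size lower bound -/

variable {m k : ℕ}

theorem ladder_adj_of_level_lt {X Y κ : Type*} {P : ℕ} {A : X → κ → Prop} {B B' : Y → κ → Prop}
    {u v : X ⊕ (κ × Fin (P + 1)) ⊕ Y} (hu : ladderLevel u < P + 2) (hv : ladderLevel v < P + 2)
    (h : (ladder P A B).Adj u v) : (ladder P A B').Adj u v := by
  have key : ∀ u v : X ⊕ (κ × Fin (P + 1)) ⊕ Y, ladderLevel u < P + 2 → ladderLevel v < P + 2 →
      LadderAdj A B u v → LadderAdj A B' u v := by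
    intro u v hu hv h
    cases h with
    | left s hs h => exact .left s hs h
    | right => exact absurd hv (lt_irrefl _)
    | rail p s s' h => exact .rail p s s' h
    | rung p q s => exact .rung p q s
  exact ⟨h.1, h.2.imp (key _ _ hu hv) (key _ _ hv hu)⟩

theorem ladder_adj_of_level_pos {X Y κ : Type*} {P : ℕ} {A A' : X → κ → Prop} {B : Y → κ → Prop}
    {u v : X ⊕ (κ × Fin (P + 1)) ⊕ Y} (hu : 0 < ladderLevel u) (hv : 0 < ladderLevel v)
    (h : (ladder P A B).Adj u v) : (ladder P A' B).Adj u v := by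
  have key : ∀ u v : X ⊕ (κ × Fin (P + 1)) ⊕ Y, 0 < ladderLevel u → 0 < ladderLevel v →
      LadderAdj A B u v → LadderAdj A' B u v := by
    intro u v hu hv h
    cases h with
    | left => exact absurd hu (lt_irrefl _)
    | right s hs h => exact .right s hs h
    | rail p s s' h => exact .rail p s s' h
    | rung p q s => exact .rung p q s
  exact ⟨h.1, h.2.imp (key _ _ hu hv) (key _ _ hv hu)⟩

theorem foolInst_weight (ha : 1 ≤ a) (hb : 0 ≤ b) {t : ℕ} (e : Fin n ≃ FoolNode m k t)
    (x y : (Fin m → Bool) → Bool) {u w : Fin n} (h : (foolInst ha hb e x y).graph.Adj u w) :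
    (foolInst ha hb e x y).weight s(u, w) = 1 :=
  if_pos h

/-- A node on the left half of the ladder does not see the right side. -/
theorem view_foolInst_left (ha : 1 ≤ a) (hb : 0 ≤ b) {t : ℕ} (e : Fin n ≃ FoolNode m k t)
    (x y y' : (Fin m → Bool) → Bool) {cert cert' : Fin n → List Bool}
    (hcert : ∀ u, ladderLevel (e u) < 2 * t + 2 → cert u = cert' u) {v : Fin n}
    (hv : ladderLevel (e v) + t < 2 * t + 2) :
    (foolInst ha hb e x y).view t cert v = (foolInst ha hb e x y').view t cert' v :=
  Inst.view_congr (f := fun u => ladderLevel (e u)) (fun _ _ => ladderLevel_le)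
    (fun _ _ => ladderLevel_le) rfl rfl
    (fun _ _ hu hw => ⟨ladder_adj_of_level_lt hu hw, ladder_adj_of_level_lt hu hw⟩)
    (fun _ _ h h' => (foolInst_weight ha hb e x y h).trans (foolInst_weight ha hb e x y' h').symm)
    hcert hv

/-- A node on the right half of the ladder does not see the left side. -/
theorem view_foolInst_right (ha : 1 ≤ a) (hb : 0 ≤ b) {t : ℕ} (e : Fin n ≃ FoolNode m k t)
    (x x' y : (Fin m → Bool) → Bool) {cert cert' : Fin n → List Bool}
    (hcert : ∀ u, 0 < ladderLevel (e u) → cert u = cert' u) {v : Fin n}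
    (hv : t < ladderLevel (e v)) :
    (foolInst ha hb e x y).view t cert v = (foolInst ha hb e x' y).view t cert' v := by
  have hle : ∀ x u w, (foolInst ha hb e x y).graph.Adj u w →
      2 * t + 2 - ladderLevel (e w) ≤ 2 * t + 2 - ladderLevel (e u) + 1 := by
    intro x u w h
    have : ladderLevel (e u) ≤ ladderLevel (e w) + 1 := ladderLevel_le h.symm
    omega
  exact Inst.view_congr (f := fun u => 2 * t + 2 - ladderLevel (e u)) (c := 2 * t + 2)
    (hle x) (hle x') rfl rfl
    (fun _ _ hu hw => ⟨ladder_adj_of_level_pos (by omega) (by omega),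
      ladder_adj_of_level_pos (by omega) (by omega)⟩)
    (fun _ _ h h' => (foolInst_weight ha hb e x y h).trans (foolInst_weight ha hb e x' y h').symm)
    (fun u hu => hcert u (by omega)) (by omega)

/-- The fooling argument: if the certificates of two correct instances, for `x` and `x'`, agree on
the rungs, then the scheme also accepts the instance that has the left side of `x` and the right
side of `x'`. This is incorrect if `x` and the complement of `x'` vanish at a common index. -/
theorem rungs_distinguish (ha : 1 ≤ a) (hb : 0 ≤ b) {t : ℕ} (e : Fin n ≃ FoolNode m k t)
    (S : PLS (Diam : Inst n a b → Prop) t) (ht : 1 ≤ t) {x x' : (Fin m → Bool) → Bool}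
    (h : ∀ z, S.prover (foolInst ha hb e x fun i => !x i) (e.symm (.inr (.inl z))) =
      S.prover (foolInst ha hb e x' fun i => !x' i) (e.symm (.inr (.inl z))))
    {i : Fin m → Bool} (hi : x i = false) (hi' : x' i = true) : False := by
  have hd : ∀ x : (Fin m → Bool) → Bool, Diam (foolInst ha hb e x fun i => !x i) :=
    fun x => diam_foolInst ha hb ht e fun i => by cases x i <;> simp
  let cert : Fin n → List Bool := fun v => match e v with
    | .inl _ => S.prover (foolInst ha hb e x fun i => !x i) v
    | .inr _ => S.prover (foolInst ha hb e x' fun i => !x' i) v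
  have hcert : ∀ u, ladderLevel (e u) < 2 * t + 2 →
      cert u = S.prover (foolInst ha hb e x fun i => !x i) u := by
    intro u hu
    obtain ⟨w, rfl⟩ := e.symm.surjective u
    rcases w with w | w | w
    · simp [cert]
    · simp [cert, h]
    · simp [ladderLevel] at hu
  have hcert' : ∀ u, 0 < ladderLevel (e u) →
      cert u = S.prover (foolInst ha hb e x' fun i => !x' i) u := by
    intro u hu
    obtain ⟨w, rfl⟩ := e.symm.surjective u
    rcases w with w | w
    · simp [ladderLevel] at hu
    · simp [cert]
  obtain ⟨v, hv⟩ := S.sound _ (not_diam_foolInst ha hb e (x := x) (y := fun i => !x' i) hi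
    (by simp [hi'])) cert
  apply hv
  by_cases hl : ladderLevel (e v) + t < 2 * t + 2
  · rw [view_foolInst_left ha hb e x _ (fun i => !x i) hcert hl]
    exact S.complete _ (hd x) v
  · rw [view_foolInst_right ha hb e x x' _ hcert' (by omega)]
    exact S.complete _ (hd x') v

/-- A scheme of size `s` distinguishes `2 ^ 2 ^ m` inputs by certificates on the
`(2 * m + 2) * (2 * t + 1)` nodes of the rungs. -/
theorem two_pow_le_size (ha : 1 ≤ a) (hb : 0 ≤ b) {t s : ℕ} (ht : 1 ≤ t)
    (hn : 2 * 2 ^ m + (2 * m + 2) * (2 * t + 1) ≤ n)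
    (S : PLS (Diam : Inst n a b → Prop) t) (hS : S.size ≤ s) :
    2 ^ m ≤ 2 * (s * ((2 * m + 2) * (2 * t + 1))) := by
  classical
  obtain ⟨k, hk⟩ := Nat.exists_eq_add_of_le hn
  have hcard : Fintype.card (FoolNode m k t) = n := by
    simp only [Fintype.card_sum, Fintype.card_prod, Fintype.card_pi, Fintype.card_bool,
      Fintype.card_fin, Finset.prod_const, Finset.card_univ]
    rw [hk]
    ring
  let e : Fin n ≃ FoolNode m k t := (Fintype.equivFinOfCardEq hcard).symm
  let I : ((Fin m → Bool) → Bool) → Inst n a b := fun x => foolInst ha hb e x fun i => !x i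
  have hlen : ∀ x v, (S.prover (I x) v).length ≤ s := by
    intro x v
    have hd : Diam (I x) := diam_foolInst ha hb ht e fun i => by cases x i <;> simp
    have h1 : ((S.prover (I x) v).length : ℕ∞) ≤ S.size :=
      le_iSup_of_le (I x) (le_iSup_of_le hd (le_iSup_of_le v le_rfl))
    exact_mod_cast h1.trans hS
  -- A bit string of length at most `s` is determined by its entries at positions below `s`.
  let F : ((Fin m → Bool) → Bool) → (Rail m × Fin (2 * t + 1) → Fin s → Option Bool) :=
    fun x z j => (S.prover (I x) (e.symm (.inr (.inl z))))[(j : ℕ)]?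
  have hF : Function.Injective F := by
    intro x x' hxx
    have h : ∀ z, S.prover (I x) (e.symm (.inr (.inl z))) =
        S.prover (I x') (e.symm (.inr (.inl z))) := by
      intro z
      apply List.ext_getElem?
      intro j
      by_cases hj : j < s
      · exact congrFun (congrFun hxx z) ⟨j, hj⟩
      · rw [List.getElem?_eq_none, List.getElem?_eq_none]
        · exact (hlen _ _).trans (not_lt.1 hj)
        · exact (hlen _ _).trans (not_lt.1 hj)
    by_contra hne
    obtain ⟨i, hi⟩ := Function.ne_iff.1 hne
    cases hx : x i <;> cases hx' : x' i
    · exact hi (hx.trans hx'.symm)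
    · exact rungs_distinguish ha hb e S ht h hx hx'
    · exact rungs_distinguish ha hb e S ht (fun z => (h z).symm) hx' hx
    · exact hi (hx.trans hx'.symm)
  have hle := Fintype.card_le_of_injective F hF
  simp only [Fintype.card_pi, Fintype.card_bool, Fintype.card_fin, Finset.prod_const,
    Finset.card_univ, Fintype.card_option, Fintype.card_sum, Fintype.card_prod] at hle
  have h3 : (2 : ℕ) ^ 2 ^ m ≤ 2 ^ (2 * (s * ((2 * m + 2) * (2 * t + 1)))) := by
    refine hle.trans ?_
    rw [← pow_mul, pow_mul 2 2, show (m * 2 + 2) = 2 * m + 2 by ring]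
    exact Nat.pow_le_pow_left (by norm_num) _
  exact (Nat.pow_le_pow_iff_right (by norm_num)).1 h3

/-- The bound of `two_pow_le_size` with `2 ^ m ≤ n / 4 < 2 ^ (m + 1)` if the rungs fit into `n`
nodes, and with `m = 0` otherwise. -/
theorem exists_lower_bound (a b : ℝ) (ha : 1 ≤ a) (hb : 0 ≤ b) :
    ∃ δ : ℝ, 0 < δ ∧ ∃ N : ℕ, ∀ n t : ℕ, N ≤ n → 1 ≤ t → (t : ℝ) ≤ (n : ℝ) / Real.log n →
      ENNReal.ofReal (δ * ((n : ℝ) / ((t : ℝ) * Real.log n))) ≤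
        (sizeDiam a b n t : ℝ≥0∞) := by
  obtain ⟨N, hN⟩ : ∃ N : ℕ, ∀ n : ℕ, N ≤ n → 16 ≤ Real.log n := by
    have := (Real.tendsto_log_atTop.comp tendsto_natCast_atTop_atTop).eventually_ge_atTop (16 : ℝ)
    exact Filter.eventually_atTop.1 this
  refine ⟨1 / 400, by norm_num, max N 16, fun n t hn ht htn => ?_⟩
  have hlog := hN n ((le_max_left _ _).trans hn)
  have hn16 : 16 ≤ n := (le_max_right _ _).trans hn
  have htR : (1 : ℝ) ≤ t := by exact_mod_cast ht
  have hnR : (16 : ℝ) ≤ n := by exact_mod_cast hn16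
  rw [le_div_iff₀ (by linarith)] at htn
  have hsize : ∀ S : PLS (Diam : Inst n a b → Prop) t,
      ENNReal.ofReal (1 / 400 * ((n : ℝ) / ((t : ℝ) * Real.log n))) ≤ (S.size : ℝ≥0∞) := by
    intro S
    cases hS : S.size with
    | top => simp
    | coe s =>
      have hpos : (0 : ℝ) < t * Real.log n := by positivity
      suffices h : 1 / 400 * ((n : ℝ) / ((t : ℝ) * Real.log n)) ≤ s by
        calc _ ≤ ENNReal.ofReal (s : ℝ) := ENNReal.ofReal_le_ofReal h
          _ = _ := by simp
      rw [← mul_div_assoc, div_le_iff₀ hpos]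
      have hsR : (0 : ℝ) ≤ s := by positivity
      by_cases hcase : 36 * (t * Real.log n) ≤ n
      · obtain ⟨m, hm⟩ : ∃ m, m = Nat.log 2 (n / 4) := ⟨_, rfl⟩
        have h1 : 2 ^ m ≤ n / 4 := hm ▸ Nat.pow_log_le_self 2 (by omega)
        have h2 : n / 4 < 2 ^ (m + 1) := hm ▸ Nat.lt_pow_succ_log_self (by norm_num) _
        have hmlog : (m + 1 : ℝ) ≤ 3 / 2 * Real.log n := by
          have h3 : (2 : ℝ) ^ (m + 1) ≤ n := by
            have : 2 ^ (m + 1) ≤ n := by rw [pow_succ]; omega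
            exact_mod_cast this
          have h4 := Real.log_le_log (by positivity) h3
          rw [Real.log_pow] at h4
          push_cast at h4
          have h5 := Real.log_two_gt_d9
          have h6 : (0 : ℝ) ≤ m := by positivity
          nlinarith
        have hfit : ((2 * m + 2) * (2 * t + 1) : ℝ) ≤ 9 * (t * Real.log n) := by
          have h3 : (2 * m + 2) * (2 * t + 1) ≤ (2 * m + 2 : ℝ) * (3 * t) := by
            gcongr
            linarith
          have h4 : (m + 1 : ℝ) * t ≤ 3 / 2 * Real.log n * t := by gcongr
          nlinarith
        have hfitN : 2 * 2 ^ m + (2 * m + 2) * (2 * t + 1) ≤ n := by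
          have h3 : (2 * (2 ^ m : ℕ) : ℝ) ≤ n / 2 := by
            have : 4 * 2 ^ m ≤ n := by omega
            have : (4 * (2 ^ m : ℕ) : ℝ) ≤ n := by exact_mod_cast this
            linarith
          have h4 : (2 * (2 ^ m : ℕ) + (2 * m + 2) * (2 * t + 1) : ℝ) ≤ n := by linarith
          exact_mod_cast h4
        have key := two_pow_le_size ha hb ht hfitN S hS.le
        have h7 : n ≤ 8 * 2 ^ (m + 1) := by omega
        have h8 : n ≤ 32 * (s * ((2 * m + 2) * (2 * t + 1))) := by
          rw [pow_succ] at h7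
          omega
        have h9 : (n : ℝ) ≤ 32 * (s * ((2 * m + 2) * (2 * t + 1))) := by exact_mod_cast h8
        have h10 : (s * ((2 * m + 2) * (2 * t + 1)) : ℝ) ≤ s * (9 * (t * Real.log n)) := by gcongr
        nlinarith
      · have hfitN : 2 * 2 ^ 0 + (2 * 0 + 2) * (2 * t + 1) ≤ n := by
          have h4 : (4 + 4 * t : ℝ) ≤ n := by nlinarith
          have : 4 + 4 * t ≤ n := by exact_mod_cast h4
          omega
        have key := two_pow_le_size ha hb ht hfitN S hS.le
        have hs : 1 ≤ s := by
          by_contra hs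
          obtain rfl : s = 0 := by omega
          simp at key
        have hs' : (1 : ℝ) ≤ s := by exact_mod_cast hs
        nlinarith
  have hiInf : ((sizeDiam a b n t : ℕ∞) : ℝ≥0∞) =
      ⨅ S : PLS (Diam : Inst n a b → Prop) t, (S.size : ℝ≥0∞) := by
    rw [sizeDiam, sizePLS, ENat.toENNReal_iInf]
  rw [hiInf]
  exact le_iInf hsize

/-! ### Encoding certificates -/

/-- The finite data of a certificate: `L` entries and two heights, all numbers having `B` bits. -/
abbrev CertData (L B : ℕ) : Type :=
  (Fin L → Fin (2 ^ B) × Fin (2 ^ B)) × Fin (2 ^ B) × Fin (2 ^ B)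

/-- The certificate given by the data. Pairs with identity `0` do not count as entries, which
allows for fewer than `L` entries. -/
def CertData.toCert {L B : ℕ} (x : CertData L B) : Cert :=
  ⟨{q | q.1 ≠ 0 ∧ ∃ k, q = ((x.1 k).1.val, (x.1 k).2.val)}, x.2.1, x.2.2⟩

theorem exists_encoding (L B : ℕ) : ∃ enc : CertData L B → List Bool,
    Function.Injective enc ∧ ∀ x, (enc x).length = B * (2 * L + 2) := by
  have hcard : Fintype.card (CertData L B) = Fintype.card (Fin (B * (2 * L + 2)) → Bool) := by
    simp only [Fintype.card_prod, Fintype.card_pi, Fintype.card_fin, Fintype.card_bool,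
      Finset.prod_const, Finset.card_univ, ← pow_add, ← pow_mul]
    ring
  exact ⟨fun x => List.ofFn (Fintype.equivOfCardEq hcard x),
    fun x y h => (Fintype.equivOfCardEq hcard).injective (List.ofFn_injective h), by simp⟩

/-- Any set of at most `L` pairs of small numbers can be stored. -/
theorem exists_certData {L B : ℕ} (s : Finset (ℕ × ℕ)) (hs : s.card ≤ L)
    (hpos : ∀ q ∈ s, q.1 ≠ 0) (hlt : ∀ q ∈ s, q.1 < 2 ^ B ∧ q.2 < 2 ^ B) {f g : ℕ}
    (hf : f < 2 ^ B) (hg : g < 2 ^ B) : ∃ x : CertData L B, x.toCert = ⟨↑s, f, g⟩ := by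
  let z : Fin (2 ^ B) := ⟨0, by positivity⟩
  let e : Fin L → Fin (2 ^ B) × Fin (2 ^ B) := fun k =>
    if h : k.1 < s.toList.length then
      have hk := hlt _ (Finset.mem_toList.1 (List.getElem_mem h))
      (⟨_, hk.1⟩, ⟨_, hk.2⟩)
    else (z, z)
  refine ⟨(e, ⟨f, hf⟩, ⟨g, hg⟩), ?_⟩
  simp only [CertData.toCert, Cert.mk.injEq, and_true]
  ext q
  simp only [Set.mem_ofPred_eq, Finset.mem_coe]
  constructor
  · rintro ⟨h0, k, rfl⟩
    by_cases h : k.1 < s.toList.length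
    · simp only [e, dif_pos h, Prod.mk.eta]
      exact Finset.mem_toList.1 (List.getElem_mem h)
    · exact absurd (by simp only [e, dif_neg h, z]) h0
  · intro hq
    obtain ⟨k, hk, rfl⟩ := List.getElem_of_mem (Finset.mem_toList.2 hq)
    refine ⟨hpos _ hq, ⟨k, by rw [Finset.length_toList] at hk; omega⟩, ?_⟩
    simp only [e, dif_pos hk]

/-- The scheme that stores `L` entries per node, where `L` bounds the load that `exists_balanced`
yields. -/
theorem exists_scheme (ht : 1 ≤ t) {L B : ℕ}
    (hL : ∀ l, t ^ n * 2 ^ l ≤ n * (t + 1) ^ n → l ≤ L)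
    (hid : ∀ (I : Inst n a b) (v : Fin n), I.id v < 2 ^ B)
    (hdist : ∀ (I : Inst n a b) (u v : Fin n), I.wdist u v < 2 ^ B) :
    ∃ S : PLS (Diam : Inst n a b → Prop) t, S.size ≤ (B * (2 * L + 2) : ℕ) := by
  classical
  obtain ⟨enc, henc, hlen⟩ := exists_encoding L B
  have hprover : ∀ I : Inst n a b, ∃ (x : Fin n → CertData L B) (r : Fin n → Fin t)
      (u₀ v₀ : Fin n), I.wdist v₀ u₀ = I.diam ∧ ∀ v, (x v).toCert =
        ⟨{q | ∃ u, I.depth u v % t = r u ∧ q = (I.id u, I.wdist v u)},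
          I.wdist v u₀, I.wdist v v₀⟩ := by
    intro I
    obtain ⟨v₀, u₀, h₀⟩ := I.exists_wdist_eq_diam
    obtain ⟨r, hr⟩ := exists_balanced ht
      (fun u v : Fin n => (⟨I.depth u v % t, Nat.mod_lt _ ht⟩ : Fin t))
    have hx : ∀ v, ∃ x : CertData L B, x.toCert =
        ⟨{q | ∃ u, I.depth u v % t = r u ∧ q = (I.id u, I.wdist v u)},
          I.wdist v u₀, I.wdist v v₀⟩ := by
      intro v
      let s : Finset (ℕ × ℕ) := (Finset.univ.filter fun u : Fin n =>
        (⟨I.depth u v % t, Nat.mod_lt _ ht⟩ : Fin t) = r u).image fun u => (I.id u, I.wdist v u)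
      have hs : ∀ q, q ∈ s ↔ ∃ u, I.depth u v % t = r u ∧ q = (I.id u, I.wdist v u) := by
        intro q
        simp [s, Fin.ext_iff, eq_comm]
      obtain ⟨x, hx⟩ := exists_certData (L := L) (B := B) s
        (Finset.card_image_le.trans (hL _ (hr v)))
        (fun q hq => by
          obtain ⟨u, -, rfl⟩ := (hs q).1 hq
          exact Nat.one_le_iff_ne_zero.1 (I.id_pos u))
        (fun q hq => by
          obtain ⟨u, -, rfl⟩ := (hs q).1 hq
          exact ⟨hid I u, hdist I v u⟩)
        (hdist I v u₀) (hdist I v v₀)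
      refine ⟨x, hx.trans ?_⟩
      congr 1
      ext q
      exact hs q
    choose x hx using hx
    exact ⟨x, r, u₀, v₀, h₀, hx⟩
  choose x r u₀ v₀ h₀ hx using hprover
  have : Nonempty (CertData L B) :=
    have z : Fin (2 ^ B) := ⟨0, by positivity⟩
    ⟨(fun _ => (z, z), z, z)⟩
  let dec : List Bool → Cert := fun l => (Function.invFun enc l).toCert
  have hdec : ∀ y, dec (enc y) = y.toCert := fun y => by
    simp only [dec, Function.leftInverse_invFun henc y]
  refine ⟨⟨fun I v => enc (x I v), fun V => ∃ D, V.Accepts dec n D, ?_, ?_⟩, ?_⟩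
  · exact fun I hI v => ⟨_, I.accepts_of_diam hI ht (h₀ I)
      (fun w => (hdec _).trans (hx I w)) v⟩
  · intro I hI cert
    by_contra! h
    exact hI (I.diam_of_accepts ht h)
  · refine iSup_le fun I => iSup_le fun _ => iSup_le fun v => ?_
    rw [hlen]

/-! ### Asymptotics -/

/-- With `2 ^ B` above all identities and distances and `L` about `log n + n / t`, the scheme has
size `O(n log² n / t)`. -/
theorem exists_scheme_le (a b : ℝ) (ha : 1 ≤ a) (hb : 0 ≤ b) :
    ∃ C : ℝ, 0 < C ∧ ∀ n t : ℕ, 2 ≤ n → 1 ≤ t → t ≤ n →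
      ∃ S : PLS (Diam : Inst n a b → Prop) t,
        (S.size : ℝ≥0∞) ≤ ENNReal.ofReal (C * ((n : ℝ) * Real.log n ^ 2 / (t : ℝ))) := by
  refine ⟨(2 * (a + b + 1) + 4) * 16, by positivity, fun n t hn ht htn => ?_⟩
  have hnR : (2 : ℝ) ≤ n := by exact_mod_cast hn
  have htR : (1 : ℝ) ≤ t := by exact_mod_cast ht
  have htnR : (t : ℝ) ≤ n := by exact_mod_cast htn
  have hl2 := Real.log_two_gt_d9
  have hlog : Real.log 2 ≤ Real.log n := Real.log_le_log (by norm_num) hnR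
  obtain ⟨q, hq⟩ : ∃ q : ℝ, q = n / t := ⟨_, rfl⟩
  have hq1 : 1 ≤ q := by rw [hq, le_div_iff₀ (by linarith)]; linarith
  obtain ⟨B, hB⟩ : ∃ B, B = ⌈(a + b + 1) * Real.log n / Real.log 2⌉₊ + 1 := ⟨_, rfl⟩
  obtain ⟨L, hL⟩ : ∃ L, L = ⌊(Real.log n + q) / Real.log 2⌋₊ := ⟨_, rfl⟩
  have hBpow : (n : ℝ) ^ (a + b + 1) < 2 ^ B := by
    have h1 : (a + b + 1) * Real.log n / Real.log 2 < B := by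
      rw [hB]
      push_cast
      linarith [Nat.le_ceil ((a + b + 1) * Real.log n / Real.log 2)]
    rw [div_lt_iff₀ (by linarith)] at h1
    rw [← Real.log_lt_log_iff (by positivity) (by positivity), Real.log_rpow (by linarith),
      Real.log_pow]
    exact h1
  have hid : ∀ (I : Inst n a b) (v : Fin n), I.id v < 2 ^ B := by
    intro I v
    have h1 : (I.id v : ℝ) < 2 ^ B := (I.id_le v).trans_lt
      ((Real.rpow_le_rpow_of_exponent_le (by linarith) (by linarith)).trans_lt hBpow)
    exact_mod_cast h1
  have hdist : ∀ (I : Inst n a b) (u v : Fin n), I.wdist u v < 2 ^ B := by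
    intro I u v
    have h1 : (n : ℝ) * (n : ℝ) ^ b ≤ (n : ℝ) ^ (a + b + 1) := by
      rw [← Real.rpow_one_add' (by linarith) (by linarith)]
      exact Real.rpow_le_rpow_of_exponent_le (by linarith) (by linarith)
    have h2 : (I.wdist u v : ℝ) < 2 ^ B := ((I.wdist_le_pow u v).trans h1).trans_lt hBpow
    exact_mod_cast h2
  have hload : ∀ l, t ^ n * 2 ^ l ≤ n * (t + 1) ^ n → l ≤ L := by
    intro l hl
    have h1 : (t : ℝ) ^ n * 2 ^ l ≤ n * (t + 1) ^ n := by exact_mod_cast hl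
    have h2 : ((t : ℝ) + 1) ^ n ≤ t ^ n * Real.exp q := by
      have h3 : (t : ℝ) + 1 ≤ t * Real.exp (1 / t) := by
        have := Real.add_one_le_exp (1 / (t : ℝ))
        calc (t : ℝ) + 1 = t * (1 / t + 1) := by field_simp; ring
          _ ≤ _ := by gcongr
      calc ((t : ℝ) + 1) ^ n ≤ (t * Real.exp (1 / t)) ^ n := by gcongr
        _ = t ^ n * Real.exp q := by
          rw [mul_pow, ← Real.exp_nat_mul, hq]
          congr 2
          ring
    have h4 : (2 : ℝ) ^ l ≤ n * Real.exp q := by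
      have h5 : (t : ℝ) ^ n * 2 ^ l ≤ t ^ n * (n * Real.exp q) := by
        calc (t : ℝ) ^ n * 2 ^ l ≤ n * (t + 1) ^ n := h1
          _ ≤ n * (t ^ n * Real.exp q) := by gcongr
          _ = _ := by ring
      exact le_of_mul_le_mul_left h5 (by positivity)
    have h6 := Real.log_le_log (by positivity) h4
    rw [Real.log_pow, Real.log_mul (by positivity) (by positivity), Real.log_exp] at h6
    rw [hL]
    exact Nat.le_floor (by rwa [le_div_iff₀ (by linarith)])
  obtain ⟨S, hS⟩ := exists_scheme (a := a) (b := b) ht hload hid hdist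
  refine ⟨S, (ENat.toENNReal_le.2 hS).trans ?_⟩
  have hBle : (B : ℝ) ≤ (2 * (a + b + 1) + 4) * Real.log n := by
    have h1 : (a + b + 1) * Real.log n / Real.log 2 ≤ 2 * (a + b + 1) * Real.log n := by
      rw [div_le_iff₀ (by linarith)]
      have : 0 ≤ (a + b + 1) * Real.log n := by positivity
      nlinarith
    have h2 := Nat.ceil_lt_add_one
      (show 0 ≤ (a + b + 1) * Real.log n / Real.log 2 by positivity)
    rw [hB]
    push_cast
    nlinarith
  have hLle : (2 * L + 2 : ℝ) ≤ 16 * (q * Real.log n) := by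
    have h1 : (L : ℝ) ≤ 2 * (Real.log n + q) := by
      rw [hL]
      refine (Nat.floor_le (by positivity)).trans ?_
      rw [div_le_iff₀ (by linarith)]
      have : 0 ≤ Real.log n + q := by linarith
      nlinarith
    have h2 : 1 / 2 * q ≤ q * Real.log n := by nlinarith
    have h3 : Real.log n ≤ q * Real.log n := by nlinarith
    linarith
  calc (((B * (2 * L + 2) : ℕ) : ℕ∞) : ℝ≥0∞) = ENNReal.ofReal ((B * (2 * L + 2) : ℕ) : ℝ) := by
        rw [ENNReal.ofReal_natCast, ENat.toENNReal_coe]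
    _ ≤ _ := by
        apply ENNReal.ofReal_le_ofReal
        push_cast
        calc (B : ℝ) * (2 * L + 2)
            ≤ ((2 * (a + b + 1) + 4) * Real.log n) * (16 * (q * Real.log n)) := by
              gcongr
          _ = _ := by
              rw [hq]
              ring

/-- On a single node the diameter is `0`, so no certificate is needed. -/
theorem sizeDiam_one (a b : ℝ) (t : ℕ) : sizeDiam a b 1 t = 0 := by
  have hdiam : ∀ I : Inst 1 a b, I.diam = 0 := by
    intro I
    obtain ⟨u, v, h⟩ := I.exists_wdist_eq_diam
    rw [← h, Subsingleton.elim u v, I.wdist_self]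
  let S : PLS (Diam : Inst 1 a b → Prop) t :=
    { prover := fun _ _ => []
      verifier := fun V => ∀ q ∈ V.nodes, q.2.1 = []
      complete := by
        rintro I hI v _ ⟨u, -, rfl⟩
        simpa [hdiam] using hI u
      sound := by
        intro I hI cert
        by_contra! h
        refine hI fun v => ?_
        simpa [hdiam] using h v _ ⟨v, by simp, rfl⟩ }
  refine le_antisymm ((iInf_le _ S).trans ?_) zero_le
  exact iSup_le fun I => iSup_le fun _ => iSup_le fun v => by simp [S]

end ProofLabeling

theorem theorem3 (a b : ℝ) (ha : 1 ≤ a) (hb : 0 ≤ b) :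
    (∃ c : ℝ, 0 < c ∧
      (∃ C : ℝ, 0 < C ∧ ∀ n t : ℕ, 1 ≤ t → c * Real.log n ≤ (t : ℝ) → (t : ℝ) ≤ (n : ℝ) →
        (ProofLabeling.sizeDiam a b n t : ℝ≥0∞) ≤
          ENNReal.ofReal (C * ((n : ℝ) * Real.log n ^ 2 / (t : ℝ)))) ∧
      (∃ C : ℝ, 0 < C ∧ ∃ k N : ℕ, ∀ n t : ℕ, N ≤ n → 1 ≤ t →
        c * Real.log n ≤ (t : ℝ) → (t : ℝ) ≤ (n : ℝ) / Real.log n →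
        ∃ S : ProofLabeling.PLS (ProofLabeling.Diam : ProofLabeling.Inst n a b → Prop) t,
          (S.size : ℝ≥0∞) ≤
            ENNReal.ofReal (C * Real.log n ^ k / (t : ℝ)) *
              (ProofLabeling.sizeDiam a b n 1 : ℝ≥0∞))) ∧
    (∃ δ : ℝ, 0 < δ ∧ ∃ N : ℕ, ∀ n t : ℕ, N ≤ n → 1 ≤ t → (t : ℝ) ≤ (n : ℝ) / Real.log n →
      ENNReal.ofReal (δ * ((n : ℝ) / ((t : ℝ) * Real.log n))) ≤
        (ProofLabeling.sizeDiam a b n t : ℝ≥0∞)) := by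
  obtain ⟨C, hC, hupper⟩ := ProofLabeling.exists_scheme_le a b ha hb
  have hlower := ProofLabeling.exists_lower_bound a b ha hb
  refine ⟨⟨1, one_pos, ⟨C, hC, fun n t ht _ htn => ?_⟩, ?_⟩, hlower⟩
  · have htn' : t ≤ n := by exact_mod_cast htn
    rcases (show n = 1 ∨ 2 ≤ n by omega) with rfl | hn
    · simp [ProofLabeling.sizeDiam_one]
    · obtain ⟨S, hS⟩ := hupper n t hn ht htn'
      exact (ENat.toENNReal_le.2 (iInf_le _ S)).trans hS
  · obtain ⟨δ, hδ, N, hN⟩ := hlower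
    refine ⟨C / δ, by positivity, 3, max N 3, fun n t hn ht _ htn => ?_⟩
    have hn3 : 3 ≤ n := (le_max_right _ _).trans hn
    have hnR : (3 : ℝ) ≤ n := by exact_mod_cast hn3
    have htR : (1 : ℝ) ≤ t := by exact_mod_cast ht
    have hlog : 1 ≤ Real.log n := by
      rw [Real.le_log_iff_exp_le (by linarith)]
      linarith [Real.exp_one_lt_d9]
    have htn' : t ≤ n := by
      have : (t : ℝ) ≤ n := htn.trans (div_le_self (by linarith) hlog)
      exact_mod_cast this
    obtain ⟨S, hS⟩ := hupper n t (by omega) ht htn'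
    refine ⟨S, hS.trans ?_⟩
    have h1 := hN n 1 ((le_max_left _ _).trans hn) le_rfl (by
      rw [Nat.cast_one]
      exact htR.trans htn)
    calc ENNReal.ofReal (C * ((n : ℝ) * Real.log n ^ 2 / (t : ℝ)))
        = ENNReal.ofReal (C / δ * Real.log n ^ 3 / t) *
            ENNReal.ofReal (δ * ((n : ℝ) / (((1 : ℕ) : ℝ) * Real.log n))) := by
          rw [← ENNReal.ofReal_mul (by positivity)]
          congr 1
          have : Real.log n ≠ 0 := by linarith
          field_simp
          simp
      _ ≤ _ := by gcongr
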